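/- Let $p$ be an odd prime and let $G$ be a finite group with $1 = G^p < G' = Z(G) < G$, where $G^p=\langle g^p : g\in G\rangle$. Let $K$ be a finite field, $\ell\ge 0$ an integer, and let $$H_\ell(K)=\left\{\begin{bmatrix}1&u&s\\0&I_\ell&v^t\\0&0&1\end{bmatrix} : s\in K,\ u,v\in K^\ell\right\}.$$ Let $\mathrm{Bi}(G): G/Z(G)\times G/Z(G)\to G'$ be the alternating biadditive map $(Z(G)x,Z(G)y)\mapsto [x,y]=x^{-1}y^{-1}xy$. For an alternating biadditive map $b:V\times V\to W$ of abelian groups, let $\mathrm{Adj}(b)$ be the ring of all pairs $(f,g)\in \mathrm{End}(V)\times\mathrm{End}(V)^{op}$ of additive endomorphisms with $b(f(u),v)=b(u,g(v))$ for all $u,v\in V$; it carries the involution $(f,g)^*=(g,f)$ and acts on $V$ through its first coordinate. A $*$-isomorphism is a ring isomorphism that commutes with the involutions. Then the following are equivalent. 1. $G$ is an epimorphic image of $H_\ell(K)$. 2. $\mathrm{Adj}(\mathrm{Bi}(G))$ acts irreducibly on $G/Z(G)$, and there are a subfield $k$ of $K$ isomorphic to the center of $\mathrm{Adj}(\mathrm{Bi}(G))$,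 a $k$-vector space structure on the abelian group $G/Z(G)$ with $\dim_k (G/Z(G)) = 2\ell\,[K:k]$, and a nondegenerate alternating $k$-form $j: G/Z(G)\times G/Z(G)\to k$, such that $\mathrm{Adj}(\mathrm{Bi}(G))$ is $*$-isomorphic to $\mathrm{Adj}(j)$. -/

import Mathlib

/-! ### Generalized Heisenberg groups -/

namespace Heisenberg

/-- The `(m + 2) × (m + 2)` block matrix with rows `(1, u, s)`, `(0, I_m, vᵗ)`, `(0, 0, 1)`. -/
def mat {K : Type*} [Field K] {m : ℕ} (u v : Fin m → K) (s : K) :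
    Matrix (Unit ⊕ Fin m ⊕ Unit) (Unit ⊕ Fin m ⊕ Unit) K
  | .inl _, .inl _ => 1
  | .inl _, .inr (.inl j) => u j
  | .inl _, .inr (.inr _) => s
  | .inr (.inl _), .inl _ => 0
  | .inr (.inl i), .inr (.inl j) => if i = j then 1 else 0
  | .inr (.inl i), .inr (.inr _) => v i
  | .inr (.inr _), .inl _ => 0
  | .inr (.inr _), .inr (.inl _) => 0
  | .inr (.inr _), .inr (.inr _) => 1

theorem mat_zero {K : Type*} [Field K] {m : ℕ} : mat (0 : Fin m → K) 0 0 = 1 := by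
  ext (i | i | i) (j | j | j) <;> simp [mat, Matrix.one_apply]

theorem mat_mul {K : Type*} [Field K] {m : ℕ} (u v u' v' : Fin m → K) (s s' : K) :
    mat u v s * mat u' v' s' = mat (u + u') (v + v') (s + s' + u ⬝ᵥ v') := by
  ext (i | i | i) (j | j | j) <;>
    simp [mat, Matrix.mul_apply, Fintype.sum_sum_type, dotProduct] <;> ring

end Heisenberg

/-- The generalized Heisenberg group `H_m(K)`, as a group of invertible matrices over `K`. -/
def HeisenbergGroup (m : ℕ) (K : Type*) [Field K] :
    Subgroup (Matrix (Unit ⊕ Fin m ⊕ Unit) (Unit ⊕ Fin m ⊕ Unit) K)ˣ where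
  carrier := {g | ∃ (u v : Fin m → K) (s : K),
    (g : Matrix (Unit ⊕ Fin m ⊕ Unit) (Unit ⊕ Fin m ⊕ Unit) K) = Heisenberg.mat u v s}
  one_mem' := ⟨0, 0, 0, by rw [Heisenberg.mat_zero]; rfl⟩
  mul_mem' := by
    rintro a b ⟨u, v, s, h⟩ ⟨u', v', s', h'⟩
    exact ⟨u + u', v + v', s + s' + u ⬝ᵥ v', by
      rw [Units.val_mul, h, h', Heisenberg.mat_mul]⟩
  inv_mem' := by
    rintro a ⟨u, v, s, h⟩
    refine ⟨-u, -v, -s + u ⬝ᵥ v, Units.inv_eq_of_mul_eq_one_right ?_⟩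
    rw [h, Heisenberg.mat_mul, ← Heisenberg.mat_zero]
    congr 1 <;> simp

/-! ### Alternating bimaps and their rings of adjoints -/

/-- An alternating biadditive map `V × V → W` (an alternating `ℤ`-bimap). -/
structure AltBimap (V W : Type*) [AddCommGroup V] [AddCommGroup W] where
  toHom : V →+ V →+ W
  map_self : ∀ v, toHom v v = 0

namespace AltBimap

variable {V W : Type*} [AddCommGroup V] [AddCommGroup W]

/-- The alternating bimap underlying an alternating `k`-form. -/
def ofForm {k : Type*} [Field k] [Module k V] (j : LinearMap.BilinForm k V) (hj : j.IsAlt) :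
    AltBimap V k where
  toHom := AddMonoidHom.mk' (fun u => (j u).toAddMonoidHom) (fun u v => by ext w; simp)
  map_self := hj

theorem neg_swap (b : AltBimap V W) (u v : V) : b.toHom u v = -b.toHom v u := by
  have h := b.map_self (u + v)
  simp only [map_add, AddMonoidHom.add_apply, b.map_self] at h
  rw [zero_add, add_zero] at h
  exact eq_neg_of_add_eq_zero_right h

/-- The adjoint ring `Adj(b) = {(f, g) ∈ End V × (End V)ᵒᵖ : b (f u, v) = b (u, g v)}`.
Endomorphisms are additive and are written on the left. -/
def adj (b : AltBimap V W) : Subring (AddMonoid.End V × (AddMonoid.End V)ᵐᵒᵖ) where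
  carrier := {a | ∀ u v, b.toHom (a.1 u) v = b.toHom u (a.2.unop v)}
  mul_mem' := by
    intro a a' h h' u v
    have h1 : b.toHom (a.1 (a'.1 u)) v = b.toHom u (a'.2.unop (a.2.unop v)) := by rw [h, h']
    exact h1
  one_mem' := fun _ _ => rfl
  add_mem' := by
    intro a a' h h' u v
    have h1 : b.toHom (a.1 u + a'.1 u) v = b.toHom u (a.2.unop v + a'.2.unop v) := by
      rw [map_add, AddMonoidHom.add_apply, h, h', map_add]
    exact h1
  zero_mem' := by
    intro u v
    have h1 : b.toHom (0 : V) v = b.toHom u (0 : V) := by simp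
    exact h1
  neg_mem' := by
    intro a h u v
    have h1 : b.toHom (-(a.1 u)) v = b.toHom u (-(a.2.unop v)) := by
      rw [map_neg, AddMonoidHom.neg_apply, h, map_neg]
    exact h1

/-- The involution `(f, g)* = (g, f)` of `Adj(b)`. -/
instance (b : AltBimap V W) : StarRing b.adj where
  star a := ⟨(a.1.2.unop, MulOpposite.op a.1.1), fun u v => by
    have h := a.2 v u
    change b.toHom (a.1.2.unop u) v = b.toHom u (a.1.1 v)
    rw [b.neg_swap, b.neg_swap u, h]⟩
  star_involutive _ := rfl
  star_mul _ _ := rfl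
  star_add _ _ := rfl

/-- `Adj(b)` acts on `V` through its first coordinate. -/
instance (b : AltBimap V W) : Module b.adj V :=
  Module.compHom V ((RingHom.fst (AddMonoid.End V) (AddMonoid.End V)ᵐᵒᵖ).comp b.adj.subtype)

end AltBimap

/-! ### The commutation bimap of a group of class at most two -/

section Bi

variable (G : Type*) [Group G] (h : commutator G ≤ Subgroup.center G)

/-- The group `G / Z(G)`, written additively; it is abelian as `G' ≤ Z(G)`. -/
def CentralQuotient (_ : commutator G ≤ Subgroup.center G) : Type _ :=
  Additive (G ⧸ Subgroup.center G)

/-- The group `G'`, written additively; it is abelian as `G' ≤ Z(G)`. -/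
def DerivedSubgroup (_ : commutator G ≤ Subgroup.center G) : Type _ :=
  Additive (commutator G)

instance : AddCommGroup (CentralQuotient G h) where
  __ := (inferInstance : AddGroup (Additive (G ⧸ Subgroup.center G)))
  add_comm := by
    have hc : ∀ a b : G ⧸ Subgroup.center G, a * b = b * a := by
      rintro ⟨x⟩ ⟨y⟩
      refine QuotientGroup.eq.2 (h ?_)
      have hm : y⁻¹ * x⁻¹ * y⁻¹⁻¹ * x⁻¹⁻¹ ∈ commutator G :=
        Subgroup.commutator_mem_commutator (Subgroup.mem_top _) (Subgroup.mem_top _)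
      simpa [mul_assoc] using hm
    exact hc

instance : AddCommGroup (DerivedSubgroup G h) where
  __ := (inferInstance : AddGroup (Additive (commutator G)))
  add_comm := by
    have hc : ∀ a b : commutator G, a * b = b * a := fun a b =>
      Subtype.ext (Subgroup.mem_center_iff.1 (h b.2) a)
    exact hc

variable {G}

/-- The class of `x` in `G / Z(G)`. -/
def CentralQuotient.mk (x : G) : CentralQuotient G h :=
  Additive.ofMul (QuotientGroup.mk x)

/-- The commutator `[x, y] = x⁻¹ y⁻¹ x y`, as an element of `G'`. -/
def DerivedSubgroup.comm (x y : G) : DerivedSubgroup G h :=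
  Additive.ofMul ⟨x⁻¹ * y⁻¹ * x * y, by
    have hm : x⁻¹ * y⁻¹ * x⁻¹⁻¹ * y⁻¹⁻¹ ∈ commutator G :=
      Subgroup.commutator_mem_commutator (Subgroup.mem_top _) (Subgroup.mem_top _)
    rwa [inv_inv, inv_inv] at hm⟩

theorem DerivedSubgroup.comm_mul_right (x y z : G) :
    comm h x (y * z) = comm h x y + comm h x z := by
  refine Subtype.ext (?_ : x⁻¹ * (y * z)⁻¹ * x * (y * z) =
    (x⁻¹ * y⁻¹ * x * y) * (x⁻¹ * z⁻¹ * x * z))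
  have hc := Subgroup.mem_center_iff.1 (h (comm h x y).2) (x⁻¹ * z⁻¹ * x)
  change x⁻¹ * z⁻¹ * x * (x⁻¹ * y⁻¹ * x * y) = (x⁻¹ * y⁻¹ * x * y) * (x⁻¹ * z⁻¹ * x) at hc
  rw [← mul_assoc (x⁻¹ * y⁻¹ * x * y), ← hc]
  group

theorem DerivedSubgroup.comm_swap (x y : G) : comm h x y = -comm h y x := by
  refine Subtype.ext (?_ : x⁻¹ * y⁻¹ * x * y = (y⁻¹ * x⁻¹ * y * x)⁻¹)
  group

theorem DerivedSubgroup.comm_mul_left (x y z : G) :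
    comm h (x * y) z = comm h x z + comm h y z := by
  rw [comm_swap, comm_mul_right, neg_add, ← comm_swap, ← comm_swap]

theorem DerivedSubgroup.comm_center (x z : G) (hz : z ∈ Subgroup.center G) :
    comm h x z = 0 := by
  refine Subtype.ext (?_ : x⁻¹ * z⁻¹ * x * z = 1)
  rw [mul_assoc, Subgroup.mem_center_iff.1 hz x]
  group

variable (G)

/-- The commutation bimap `Bi(G) : G/Z(G) × G/Z(G) → G'`, `(Z(G)x, Z(G)y) ↦ [x, y]`. -/
def Bi : AltBimap (CentralQuotient G h) (DerivedSubgroup G h) where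
  toHom := AddMonoidHom.mk' (fun a => AddMonoidHom.mk'
      (fun b => Quotient.liftOn₂' (Additive.toMul a) (Additive.toMul b) (DerivedSubgroup.comm h)
        (by
          intro x y x' y' hx hy
          rw [QuotientGroup.leftRel_apply] at hx hy
          obtain ⟨z, hz, rfl⟩ : ∃ z ∈ Subgroup.center G, x' = x * z := ⟨_, hx, by group⟩
          obtain ⟨w, hw, rfl⟩ : ∃ w ∈ Subgroup.center G, y' = y * w := ⟨_, hy, by group⟩
          rw [DerivedSubgroup.comm_mul_left, DerivedSubgroup.comm_mul_right,
            DerivedSubgroup.comm_swap h z, DerivedSubgroup.comm_center h _ z hz,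
            DerivedSubgroup.comm_center h _ w hw, neg_zero, add_zero, add_zero]))
      (by
        rintro ⟨y⟩ ⟨z⟩
        induction a using Quotient.inductionOn' with
        | h x => exact DerivedSubgroup.comm_mul_right h x y z))
    (by
      rintro ⟨x⟩ ⟨y⟩
      ext ⟨z⟩
      exact DerivedSubgroup.comm_mul_left h x y z)
  map_self := by
    rintro ⟨x⟩
    refine Subtype.ext (?_ : x⁻¹ * x⁻¹ * x * x = 1)
    group

theorem Bi_mk (x y : G) :
    (Bi G h).toHom (CentralQuotient.mk h x) (CentralQuotient.mk h y) =
      DerivedSubgroup.comm h x y := rfl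

end Bi

/-! ### Isometry of nondegenerate alternating forms -/

section Symplectic

variable {k : Type*} [Field k]

/-! Both conditions amount to the same thing: up to an additive isomorphism of `K^l × K^l` with
`G/Z(G)`, the bimap `Bi(G)` is the standard symplectic `K`-form followed by an additive map `ν : K →
G'`. An epimorphism from `H_l(K)` induces such a factorization (`exists_coords_of_surjective`).
Conversely, exponent `p` lets the two Lagrangian halves of `K^l × K^l` lift to abelian subgroups of
`G`, which assemble into an epimorphism (`exists_surjective_of_coords`).

From the factorization to adjoints (`exists_subfield_form`): the kernel of `ν` is cut out by traces
`Tr(m s) = 0`, `m ∈ M`. Fix a nonzero `m₀ ∈ M` and let `k` be generated by the ratios `m / m₀`.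
Being adjoint for all the forms `Tr(m J)` forces `k`-linearity, so `Adj(Bi(G))` equals `Adj(j)` for
`j = Tr_{K/k}(m₀ J)`. Rank one adjoints then give irreducibility and the center.

From adjoints back: a `*`-isomorphism carries the left ideal of rank one adjoints to a copy of `V`,
so `Bi(G)` is an additive image of `j` (`exists_factorization_of_adj_equiv`). By dimension, `j` is
isometric to the `K/k`-trace of the standard form. -/

/-- A nondegenerate alternating form splits off a hyperbolic plane. -/
theorem LinearMap.BilinForm.IsAlt.exists_hyperbolic_splitting {V : Type*} [AddCommGroup V]
    [Module k V] [Nontrivial V] {B : LinearMap.BilinForm k V} (hB : B.IsAlt)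
    (hnd : LinearMap.Nondegenerate B) :
    ∃ (H : Submodule k V) (e : V ≃ₗ[k] (k × k) × H),
      (∀ x y, B x y = (e x).1.1 * (e y).1.2 - (e x).1.2 * (e y).1.1 + B (e x).2 (e y).2) ∧
      LinearMap.Nondegenerate (B.restrict H) := by
  obtain ⟨a, ha⟩ := exists_ne (0 : V)
  obtain ⟨b, hab⟩ : ∃ b, B a b = 1 := by
    by_contra! hc
    refine ha (hnd.1 a fun y => ?_)
    by_contra hy
    exact hc ((B a y)⁻¹ • y) (by simp [hy])
  have hs : ∀ x y, B y x = -B x y := fun x y => (hB.neg_eq x y).symm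
  have haa := hB.self_eq_zero a
  have hbb := hB.self_eq_zero b
  have hba : B b a = -1 := by rw [hs, hab]
  let H : Submodule k V := LinearMap.ker (B a) ⊓ LinearMap.ker (B b)
  have hH : ∀ x, x ∈ H ↔ B a x = 0 ∧ B b x = 0 := fun x => by
    simp only [H, Submodule.mem_inf, LinearMap.mem_ker]
  -- If `x = s a + t b + w` with `w ∈ H`, then `s = B x b` and `t = B a x`; subtracting these parts
  -- leaves `w`.
  let pr : V →ₗ[k] H := LinearMap.codRestrict H
    (LinearMap.id - (B.flip b).smulRight a - (B a).smulRight b) fun x => by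
      rw [hH]
      constructor
      · simp [haa, hab]
      · simp [hbb, hba, hs b x]
  let f : V →ₗ[k] (k × k) × H := ((B.flip b).prod (B a)).prod pr
  let g : (k × k) × H →ₗ[k] V := LinearMap.coprod
    (LinearMap.coprod (LinearMap.toSpanSingleton k V a) (LinearMap.toSpanSingleton k V b)) H.subtype
  have hgf : ∀ x, g (f x) = x := fun x => by simp [f, g, pr]
  have hfg : ∀ x, f (g x) = x := by
    rintro ⟨⟨s, t⟩, ⟨w, hw⟩⟩
    obtain ⟨h1, h2⟩ := (hH w).1 hw
    have h3 : B w b = 0 := by rw [hs, h2, neg_zero]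
    ext <;> simp [f, g, pr, haa, hbb, hab, h1, h3]
  refine ⟨H, LinearEquiv.ofLinearMap f g (LinearMap.ext hfg) (LinearMap.ext hgf), ?_, ?_⟩
  · intro x y
    have key : ∀ s t s' t' (w w' : H), B (g ((s, t), w)) (g ((s', t'), w')) =
        s * t' - t * s' + B w w' := by
      rintro s t s' t' ⟨w, hw⟩ ⟨w', hw'⟩
      obtain ⟨h1, h2⟩ := (hH w).1 hw
      obtain ⟨h1', h2'⟩ := (hH w').1 hw'
      have h3 : B w b = 0 := by rw [hs, h2, neg_zero]
      have h4 : B w a = 0 := by rw [hs, h1, neg_zero]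
      simp [g, haa, hbb, hab, hba, h3, h4, h1', h2']
      ring
    conv_lhs => rw [← hgf x, ← hgf y]
    exact key _ _ _ _ _ _
  -- A vector of `H` orthogonal to `H` is also orthogonal to `a` and `b`, hence to all of `V`.
  · have hL : LinearMap.SeparatingLeft (B.restrict H) := by
      rintro ⟨x, hx⟩ h
      refine Subtype.ext (hnd.1 x fun y => ?_)
      obtain ⟨h1, h2⟩ := (hH x).1 hx
      have h3 : B x b = 0 := by rw [hs, h2, neg_zero]
      have h4 : B x a = 0 := by rw [hs, h1, neg_zero]
      have h5 : B x (pr y) = 0 := h (pr y)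
      rw [← hgf y]
      simp [g, f, h3, h4, h5]
    refine ⟨hL, fun y h => hL y fun x => ?_⟩
    have := h x
    rw [LinearMap.BilinForm.restrict_apply] at this ⊢
    simpa [hs (x : V) y] using this

/-- Nondegenerate alternating forms on spaces of the same finite dimension are isometric. -/
theorem LinearMap.BilinForm.IsAlt.exists_isometry {V V' : Type*} [AddCommGroup V]
    [Module k V] [FiniteDimensional k V] [AddCommGroup V'] [Module k V'] [FiniteDimensional k V']
    {B : LinearMap.BilinForm k V} (hB : B.IsAlt) (hnd : LinearMap.Nondegenerate B)
    {B' : LinearMap.BilinForm k V'} (hB' : B'.IsAlt) (hnd' : LinearMap.Nondegenerate B')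
    (hdim : Module.finrank k V = Module.finrank k V') :
    ∃ e : V ≃ₗ[k] V', ∀ x y, B' (e x) (e y) = B x y := by
  induction hn : Module.finrank k V using Nat.strong_induction_on generalizing V V' with
  | _ n ih =>
  subst hn
  rcases subsingleton_or_nontrivial V with hV | hV
  · refine ⟨LinearEquiv.ofFinrankEq V V' hdim, fun x y => ?_⟩
    rw [Subsingleton.elim x 0]
    simp
  have hV' : Nontrivial V' := by
    rw [← Module.finrank_pos_iff (R := k), ← hdim]
    exact Module.finrank_pos
  obtain ⟨H, e, he, hH⟩ := hB.exists_hyperbolic_splitting hnd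
  obtain ⟨H', e', he', hH'⟩ := hB'.exists_hyperbolic_splitting hnd'
  have h1 := e.finrank_eq
  have h2 := e'.finrank_eq
  rw [Module.finrank_prod, Module.finrank_prod, Module.finrank_self] at h1 h2
  obtain ⟨i, hi⟩ := ih (Module.finrank k H) (by omega) (B := B.restrict H) (fun x => hB x) hH
    (B' := B'.restrict H') (fun x => hB' x) hH' (by omega) rfl
  refine ⟨(e.trans ((LinearEquiv.refl k (k × k)).prodCongr i)).trans e'.symm, fun x y => ?_⟩
  have hi' : ∀ x y : H, B' (i x) (i y) = B x y := hi
  rw [he, he']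
  simp [hi']

end Symplectic

/-! ### The adjoint ring of a nondegenerate alternating form -/

namespace AltBimap

section General

variable {V W : Type*} [AddCommGroup V] [AddCommGroup W] {b : AltBimap V W}

theorem adj_apply (a : b.adj) (u v : V) : b.toHom (a • u) v = b.toHom u (star a • v) := a.2 u v

/-- An adjoint of a nondegenerate bimap is determined by its action. -/
theorem adj_ext (hb : ∀ v, (∀ u, b.toHom u v = 0) → v = 0) {a a' : b.adj}
    (h : ∀ v : V, a • v = a' • v) : a = a' := by
  refine Subtype.ext (Prod.ext (AddMonoidHom.ext h) (MulOpposite.unop_injective ?_))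
  refine AddMonoidHom.ext fun v => sub_eq_zero.1 (hb _ fun u => ?_)
  change b.toHom u (star a • v - star a' • v) = 0
  rw [map_sub, sub_eq_zero, ← adj_apply, ← adj_apply, h u]

end General

section Form

variable {k V : Type*} [Field k] [AddCommGroup V] [Module k V]
  {j : LinearMap.BilinForm k V} {hj : j.IsAlt}

theorem form_smul (a : (ofForm j hj).adj) (u v : V) : j (a • u) v = j u (star a • v) := a.2 u v

variable (hj) in
/-- The rank one adjoint `x ↦ j(x, w) u`. -/
def rankOne (u w : V) : (ofForm j hj).adj :=
  ⟨(((j.flip w).smulRight u).toAddMonoidHom, MulOpposite.op ((j u).smulRight w).toAddMonoidHom),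
    fun x y => by
      change j (j x w • u) y = j x (j u y • w)
      simp [mul_comm]⟩

theorem rankOne_smul (u w x : V) : rankOne hj u w • x = j x w • u := rfl

theorem star_rankOne_smul (u w x : V) : star (rankOne hj u w) • x = j u x • w := rfl

theorem ofForm_nondegenerate (hnd : LinearMap.Nondegenerate j) (v : V)
    (h : ∀ u, (ofForm j hj).toHom u v = 0) : v = 0 := hnd.2 v h

theorem exists_form_eq_one (hnd : LinearMap.Nondegenerate j) {v : V} (hv : v ≠ 0) :
    ∃ w, j v w = 1 := by
  by_contra! hc
  refine hv (hnd.1 v fun y => ?_)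
  by_contra hy
  exact hc ((j v y)⁻¹ • y) (by simp [hy])

/-- Adjoints of a nondegenerate form are linear. -/
theorem adj_smul_smul (hnd : LinearMap.Nondegenerate j) (a : (ofForm j hj).adj) (c : k) (v : V) :
    a • (c • v) = c • (a • v) := by
  refine sub_eq_zero.1 (hnd.1 _ fun y => ?_)
  rw [map_sub, LinearMap.sub_apply, form_smul, LinearMap.map_smul, LinearMap.map_smul,
    LinearMap.smul_apply, LinearMap.smul_apply, form_smul, sub_self]

/-- For fixed nonzero `w` the rank one adjoints form a left ideal that is a copy of the module `V`;
a ring isomorphism can transport it. -/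
theorem mul_rankOne (hnd : LinearMap.Nondegenerate j) (a : (ofForm j hj).adj) (u w : V) :
    a * rankOne hj u w = rankOne hj (a • u) w :=
  adj_ext (ofForm_nondegenerate hnd) fun v => by
    rw [mul_smul, rankOne_smul, rankOne_smul, adj_smul_smul hnd]

theorem rankOne_add (u u' w : V) : rankOne hj (u + u') w = rankOne hj u w + rankOne hj u' w := by
  refine Subtype.ext (Prod.ext (AddMonoidHom.ext fun x => ?_)
    (MulOpposite.unop_injective (AddMonoidHom.ext fun x => ?_)))
  · exact smul_add (j x w) u u'
  · change j (u + u') x • w = j u x • w + j u' x • w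
    rw [map_add, LinearMap.add_apply, add_smul]

/-- A bimap admitting the adjoints of a nondegenerate form has irreducible adjoint ring. -/
theorem isSimpleModule_adj_of_le [Nontrivial V] (hnd : LinearMap.Nondegenerate j)
    {W : Type*} [AddCommGroup W] {b : AltBimap V W} (hle : (ofForm j hj).adj ≤ b.adj) :
    IsSimpleModule b.adj V := by
  rw [isSimpleModule_iff_toSpanSingleton_surjective]
  refine ⟨inferInstance, fun v hv u => ?_⟩
  obtain ⟨w, hw⟩ := exists_form_eq_one hnd hv
  -- Since `j v w = 1`, this adjoint sends the given nonzero `v` to the arbitrary `u`.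
  refine ⟨⟨_, hle (rankOne hj u w).2⟩, ?_⟩
  change j v w • u = u
  rw [hw, one_smul]

variable (hj) in
/-- Scalars as adjoints of a form. -/
def scalar : k →+* (ofForm j hj).adj where
  toFun c := ⟨(DistribSMul.toAddMonoidHom V c, MulOpposite.op (DistribSMul.toAddMonoidHom V c)),
    fun x y => by
      change j (c • x) y = j x (c • y)
      simp⟩
  map_one' := by
    refine Subtype.ext (Prod.ext ?_ (MulOpposite.unop_injective ?_)) <;>
      exact AddMonoidHom.ext (one_smul k)
  map_zero' := by
    refine Subtype.ext (Prod.ext ?_ (MulOpposite.unop_injective ?_)) <;>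
      exact AddMonoidHom.ext (zero_smul k)
  map_mul' c d := by
    refine Subtype.ext (Prod.ext ?_ (MulOpposite.unop_injective ?_))
    · exact AddMonoidHom.ext (mul_smul c d)
    · rw [mul_comm]
      exact AddMonoidHom.ext (mul_smul d c)
  map_add' c d := by
    refine Subtype.ext (Prod.ext ?_ (MulOpposite.unop_injective ?_)) <;>
      exact AddMonoidHom.ext (add_smul c d)

theorem scalar_smul (c : k) (v : V) : scalar hj c • v = c • v := rfl

/-- The center of the adjoint ring of a nondegenerate form consists of the scalars. -/
theorem nonempty_equiv_center [Nontrivial V] (hnd : LinearMap.Nondegenerate j) :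
    Nonempty (k ≃+* Subring.center (ofForm j hj).adj) := by
  have hmem : ∀ c, scalar hj c ∈ Subring.center (ofForm j hj).adj := fun c => by
    rw [Subring.mem_center_iff]
    refine fun a => adj_ext (ofForm_nondegenerate hnd) fun v => ?_
    rw [mul_smul, mul_smul, scalar_smul, scalar_smul, adj_smul_smul hnd]
  obtain ⟨v, hv⟩ := exists_ne (0 : V)
  obtain ⟨w, hw⟩ := exists_form_eq_one hnd hv
  refine ⟨RingEquiv.ofBijective ((scalar hj).codRestrict _ hmem) ⟨fun c d h => ?_, ?_⟩⟩
  · have h1 : scalar hj c • v = scalar hj d • v := congrArg (· • v) (congrArg Subtype.val h)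
    exact smul_left_injective k hv h1
  · rintro ⟨z, hz⟩
    -- Commuting with `x ↦ j(x, w) u` and evaluating at `v`, where `j v w = 1`, gives `j(z v, w) u =
    -- z u` for every `u`.
    refine ⟨j (z • v) w, Subtype.ext (adj_ext (ofForm_nondegenerate hnd) fun u => ?_)⟩
    have h1 := Subring.mem_center_iff.1 hz (rankOne hj u w)
    have h2 : (rankOne hj u w * z) • v = (z * rankOne hj u w) • v := by rw [h1]
    rw [mul_smul, mul_smul, rankOne_smul, rankOne_smul, hw, one_smul] at h2
    exact h2

/-- A nondegenerate bimap with the adjoints of a nondegenerate form factors through the form. -/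
theorem exists_factorization_of_adj_equiv {W : Type*} [AddCommGroup W] [Finite V] [Nontrivial V]
    {b : AltBimap V W} (hb : ∀ v, (∀ u, b.toHom u v = 0) → v = 0)
    (hnd : LinearMap.Nondegenerate j) (χ : (ofForm j hj).adj ≃⋆+* b.adj) :
    ∃ (θ : V ≃+ V) (τ : k →+ W), ∀ x y, b.toHom (θ x) (θ y) = τ (j x y) := by
  obtain ⟨w₀, hw₀⟩ := exists_ne (0 : V)
  obtain ⟨w₁, hw₁⟩ := exists_form_eq_one hnd hw₀
  obtain ⟨x₀, hx₀⟩ : ∃ x₀ : V, χ (rankOne hj w₁ w₁) • x₀ ≠ 0 := by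
    by_contra! hc
    have h0 : χ (rankOne hj w₁ w₁) = 0 := adj_ext hb fun v => by rw [hc, zero_smul]
    rw [EmbeddingLike.map_eq_zero_iff] at h0
    have h1 : rankOne hj w₁ w₁ • w₀ = 0 := by rw [h0, zero_smul]
    rw [rankOne_smul, hw₁, one_smul] at h1
    rw [h1, map_zero] at hw₁
    exact zero_ne_one hw₁
  -- Identify `V` with the left ideal of the `rankOne v w₁`, apply `χ`, and evaluate at `x₀`: the
  -- result intertwines the two actions.
  let θ : V →+ V := AddMonoidHom.mk' (fun v => χ (rankOne hj v w₁) • x₀) fun v v' => by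
    rw [rankOne_add, map_add, add_smul]
  have hθ : ∀ (a : (ofForm j hj).adj) v, θ (a • v) = χ a • θ v := fun a v => by
    change χ (rankOne hj (a • v) w₁) • x₀ = χ a • χ (rankOne hj v w₁) • x₀
    rw [← mul_smul, ← map_mul, mul_rankOne hnd]
  -- A nonzero kernel vector could be moved to `w₁` by an adjoint, but `θ w₁ ≠ 0` by the choice of
  -- `x₀`.
  have hinj : Function.Injective θ := by
    rw [injective_iff_map_eq_zero]
    intro v hv
    by_contra hv0
    obtain ⟨w, hw⟩ := exists_form_eq_one hnd hv0
    have h1 := hθ (rankOne hj w₁ w) v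
    rw [rankOne_smul, hw, one_smul, hv, smul_zero] at h1
    exact hx₀ h1
  have hadj : ∀ (a : (ofForm j hj).adj) x y,
      b.toHom (θ (a • x)) (θ y) = b.toHom (θ x) (θ (star a • y)) := fun a x y => by
    rw [hθ, adj_apply, hθ, map_star]
  refine ⟨AddEquiv.ofBijective θ (Finite.injective_iff_bijective.1 hinj),
    AddMonoidHom.mk' (fun c => b.toHom (θ w₀) (θ (c • w₁))) fun c d => ?_, fun x y => ?_⟩
  · rw [add_smul, map_add, map_add]
  · change b.toHom (θ x) (θ y) = b.toHom (θ w₀) (θ (j x y • w₁))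
    -- With `a = rankOne x w₁`, `star a` sends `y` to `j(x, y) w₁` and `a` sends `w₀` to `x`; moving
    -- `a` across `b` finishes.
    rw [← star_rankOne_smul (hj := hj), ← hadj, rankOne_smul, hw₁, one_smul]

end Form

end AltBimap

/-! ### Additive images of a symplectic form over a finite field -/

theorem Algebra.eq_of_trace_mul_eq (F : Type*) {L : Type*} [Field F] [Field L] [Algebra F L]
    [FiniteDimensional F L] [Algebra.IsSeparable F L] {x y : L}
    (h : ∀ c, Algebra.trace F L (c * x) = Algebra.trace F L (c * y)) : x = y := by
  refine sub_eq_zero.1 ((traceForm_nondegenerate F L).2 _ fun c => ?_)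
  rw [Algebra.traceForm_apply, mul_sub, map_sub, h, sub_self]

/-- The trace of a multiple of a bilinear form, as a form over a subfield. -/
noncomputable def LinearMap.BilinForm.traceDown {k K V : Type*} [Field k] [Field K] [Algebra k K]
    [AddCommGroup V] [Module K V] [Module k V] [IsScalarTower k K V]
    (J : LinearMap.BilinForm K V) (m : K) : LinearMap.BilinForm k V :=
  LinearMap.mk₂ k (fun u v => Algebra.trace k K (m * J u v))
    (fun u u' v => by rw [map_add, LinearMap.add_apply, mul_add, map_add])
    (fun c u v => by
      rw [← algebraMap_smul K c u, map_smul, LinearMap.smul_apply, smul_eq_mul, mul_left_comm,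
        ← Algebra.smul_def, map_smul])
    (fun u v v' => by rw [map_add, mul_add, map_add])
    (fun c u v => by
      rw [← algebraMap_smul K c v, map_smul, smul_eq_mul, mul_left_comm, ← Algebra.smul_def,
        map_smul])

namespace LinearMap.BilinForm

variable {k K V : Type*} [Field k] [Field K] [Algebra k K]
  [AddCommGroup V] [Module K V] [Module k V] [IsScalarTower k K V]

theorem traceDown_apply (J : LinearMap.BilinForm K V) (m : K) (u v : V) :
    (J.traceDown m : LinearMap.BilinForm k V) u v = Algebra.trace k K (m * J u v) := rfl

theorem IsAlt.traceDown {J : LinearMap.BilinForm K V} (hJ : J.IsAlt) (m : K) :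
    (J.traceDown m : LinearMap.BilinForm k V).IsAlt := fun u => by
  rw [traceDown_apply, hJ.self_eq_zero, mul_zero, map_zero]

/-- The radical is stable under `K`-scaling of the test vector, which puts all multiples of `m * J u
v` under the trace; the trace form is nondegenerate. -/
theorem traceDown_nondegenerate [FiniteDimensional k K] [Algebra.IsSeparable k K]
    {J : LinearMap.BilinForm K V} (hnd : LinearMap.Nondegenerate J) {m : K} (hm : m ≠ 0) :
    LinearMap.Nondegenerate (J.traceDown m : LinearMap.BilinForm k V) := by
  constructor
  · intro u h
    refine hnd.1 u fun v => (mul_eq_zero_iff_left hm).1 (Algebra.eq_of_trace_mul_eq k fun c => ?_)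
    have h1 := h (c • v)
    rw [traceDown_apply, map_smul, smul_eq_mul, mul_left_comm] at h1
    rw [h1, mul_zero, map_zero]
  · intro v h
    refine hnd.2 v fun u => (mul_eq_zero_iff_left hm).1 (Algebra.eq_of_trace_mul_eq k fun c => ?_)
    have h1 := h (c • u)
    rw [traceDown_apply, map_smul, LinearMap.smul_apply, smul_eq_mul, mul_left_comm] at h1
    rw [h1, mul_zero, map_zero]

end LinearMap.BilinForm

/-- Every additive map out of a finite field is detected by a nonzero space of traces. -/
theorem AddMonoidHom.exists_trace_detecting (p : ℕ) [Fact p.Prime] {K W : Type*} [Field K]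
    [Finite K] [Algebra (ZMod p) K] [AddCommGroup W] (ν : K →+ W) (hν : ν ≠ 0) :
    ∃ M : Set K, (∃ m ∈ M, m ≠ 0) ∧ ∀ s t, ν s = ν t ↔
      ∀ m ∈ M, Algebra.trace (ZMod p) K (m * s) = Algebra.trace (ZMod p) K (m * t) := by
  let T := Algebra.traceForm (ZMod p) K
  let N : Submodule (ZMod p) K := AddSubgroup.toZModSubmodule p ν.ker
  have hTr : T.IsRefl := (Algebra.traceForm_isSymm (ZMod p)).isRefl
  have hN : T.orthogonal (T.orthogonal N) = N :=
    LinearMap.BilinForm.orthogonal_orthogonal (traceForm_nondegenerate (ZMod p) K) hTr N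
  -- The kernel of `ν` is its own double orthogonal for the trace form.
  have hmem : ∀ s, ν s = 0 ↔ ∀ m ∈ T.orthogonal N, Algebra.trace (ZMod p) K (m * s) = 0 := by
    intro s
    change s ∈ N ↔ _
    rw [← hN, LinearMap.BilinForm.mem_orthogonal_iff, hN]
    rfl
  refine ⟨T.orthogonal N, ?_, fun s t => ?_⟩
  · by_contra! hc
    refine hν (AddMonoidHom.ext fun s => (hmem s).2 fun m hm => ?_)
    rw [hc m hm, zero_mul, map_zero]
  · rw [← sub_eq_zero, ← map_sub, hmem]
    simp only [mul_sub, map_sub, sub_eq_zero, SetLike.mem_coe]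

namespace AltBimap

/-- The adjoint ring of an additive image of a symplectic form over a finite field is the adjoint
ring of a symplectic form over a subfield. -/
theorem exists_subfield_form {K V W : Type*} [Field K] [Finite K] [AddCommGroup V] [Module K V]
    [AddCommGroup W] {b : AltBimap V W} {J : LinearMap.BilinForm K V} (hJ : J.IsAlt)
    (hnd : LinearMap.Nondegenerate J) {ν : K →+ W} (hν : ν ≠ 0)
    (hb : ∀ u v, b.toHom u v = ν (J u v)) :
    ∃ (k : Subfield K) (j : LinearMap.BilinForm k V) (hj : j.IsAlt),
      LinearMap.Nondegenerate j ∧ b.adj = (ofForm j hj).adj := by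
  obtain ⟨p, hchar⟩ := CharP.exists K
  have : Fact p.Prime := ⟨CharP.char_is_prime K p⟩
  let _ := ZMod.algebra K p
  obtain ⟨M, ⟨m₀, hm₀, hne⟩, hM⟩ := ν.exists_trace_detecting p hν
  -- Over this field all of `M` lies on the line `k m₀`, so one `k`-form encodes every `Tr(m J)`.
  let k : Subfield K := Subfield.closure ((fun m => m / m₀) '' M)
  have hk : ∀ m ∈ M, ∃ c : k, m = c * m₀ := fun m hm =>
    ⟨⟨m / m₀, Subfield.subset_closure ⟨m, hm, rfl⟩⟩, (div_mul_cancel₀ m hne).symm⟩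
  have : CharP k p := 
    (RingHom.charP_iff (algebraMap k K) (algebraMap k K).injective p).2 hchar
  let _ := ZMod.algebra k p
  have : @IsScalarTower (ZMod p) k K Algebra.toSMul _ _ :=
    IsScalarTower.of_algebraMap_eq' (RingHom.ext_zmod _ _)
  let j : LinearMap.BilinForm k V := J.traceDown m₀
  have hj : j.IsAlt := hJ.traceDown m₀
  have hjnd : LinearMap.Nondegenerate j := LinearMap.BilinForm.traceDown_nondegenerate hnd hne
  have htr : ∀ (c : k) u v, Algebra.trace (ZMod p) k (c * j u v) =
      Algebra.trace (ZMod p) K (c * m₀ * J u v) := fun c u v => by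
    rw [← smul_eq_mul, LinearMap.BilinForm.traceDown_apply, ← map_smul, Algebra.trace_trace,
      mul_assoc, Algebra.smul_def]
    rfl
  refine ⟨k, j, hj, hjnd, Subring.ext fun a => ⟨fun ha => ?_, fun ha => ?_⟩⟩
  · have hadj : ∀ u v, ∀ m ∈ M, Algebra.trace (ZMod p) K (m * J (a.1 u) v) =
        Algebra.trace (ZMod p) K (m * J u (a.2.unop v)) := fun u v => by
      rw [← hM, ← hb, ← hb]
      exact ha u v
    -- The scalars commuting with `a.1` form a field, so it suffices to test the generators of `k`.
    let D : Subfield K :=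
      { carrier := {c | ∀ u, a.1 (c • u) = c • a.1 u}
        mul_mem' := fun {c d} hc hd u => by rw [mul_smul, hc, hd, mul_smul]
        one_mem' := fun u => by rw [one_smul, one_smul]
        add_mem' := fun {c d} hc hd u => by rw [add_smul, map_add, hc, hd, add_smul]
        zero_mem' := fun u => by rw [zero_smul, zero_smul, map_zero]
        neg_mem' := fun {c} hc u => by rw [neg_smul, map_neg, hc, neg_smul]
        inv_mem' := fun c hc u => by
          rcases eq_or_ne c 0 with rfl | h0
          · rw [inv_zero, zero_smul, zero_smul, map_zero]
          · rw [← inv_smul_smul₀ h0 (a.1 (c⁻¹ • u)), ← hc, smul_inv_smul₀ h0] }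
    have hD : k ≤ D := by
      rw [Subfield.closure_le]
      rintro _ ⟨m, hm, rfl⟩ u
      refine sub_eq_zero.1 (hnd.1 _ fun v => ?_)
      rw [map_sub, LinearMap.sub_apply, sub_eq_zero]
      refine mul_left_cancel₀ hne (Algebra.eq_of_trace_mul_eq (ZMod p) fun c => ?_)
      -- Pass to the adjoint side using `m₀`, absorb `m / m₀` to turn `m₀` into `m`, then return
      -- using `m`.
      have h1 := hadj ((m / m₀) • u) (c • v) m₀ hm₀
      have h2 := hadj u (c • v) m hm
      simp only [map_smul, LinearMap.smul_apply, smul_eq_mul] at h1 h2 ⊢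
      have h4 : c * (m₀ * (m / m₀ * J (a.1 u) v)) = m * (c * J (a.1 u) v) := by
        field_simp
      rw [mul_left_comm, h1, h4, h2, ← mul_assoc, mul_div_cancel₀ m hne]
    intro u v
    refine Algebra.eq_of_trace_mul_eq (ZMod p) fun c => ?_
    have h1 := hadj ((c : K) • u) v m₀ hm₀
    rw [hD c.2 u] at h1
    simp only [map_smul, LinearMap.smul_apply, smul_eq_mul] at h1
    change Algebra.trace (ZMod p) k (c * j (a.1 u) v) =
      Algebra.trace (ZMod p) k (c * j u (a.2.unop v))
    rw [htr, htr, mul_assoc, mul_left_comm, h1]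
    congr 1
    ring
  · intro u v
    rw [hb, hb, hM]
    intro m hm
    obtain ⟨c, rfl⟩ := hk m hm
    rw [← htr, ← htr]
    exact congrArg (fun x => Algebra.trace (ZMod p) k (c * x)) (ha u v)

end AltBimap

/-! ### Coordinates on the Heisenberg group -/

namespace Heisenberg

variable {K : Type*} [Field K] {m : ℕ}

/-- The element of the Heisenberg group with prescribed coordinates. -/
def elem (u v : Fin m → K) (s : K) : HeisenbergGroup m K :=
  ⟨⟨mat u v s, mat (-u) (-v) (-s + u ⬝ᵥ v),
    by rw [mat_mul, ← mat_zero]; congr 1 <;> simp,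
    by rw [mat_mul, ← mat_zero]; congr 1 <;> simp⟩, u, v, s, rfl⟩

theorem elem_mul (u v u' v' : Fin m → K) (s s' : K) :
    elem u v s * elem u' v' s' = elem (u + u') (v + v') (s + s' + u ⬝ᵥ v') :=
  Subtype.ext (Units.ext (mat_mul u v u' v' s s'))

theorem exists_eq_elem (g : HeisenbergGroup m K) : ∃ u v s, g = elem u v s := by
  obtain ⟨g, u, v, s, h⟩ := g
  exact ⟨u, v, s, Subtype.ext (Units.ext h)⟩

/-- A function of the coordinates that is multiplicative defines a homomorphism. -/
def homOfCoords {G : Type*} [Group G] (f : (Fin m → K) → (Fin m → K) → K → G)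
    (hf : ∀ u v u' v' s s', f u v s * f u' v' s' = f (u + u') (v + v') (s + s' + u ⬝ᵥ v')) :
    HeisenbergGroup m K →* G :=
  MonoidHom.mk' (fun g => f (fun i => g.1.1 (.inl ()) (.inr (.inl i)))
      (fun i => g.1.1 (.inr (.inl i)) (.inr (.inr ()))) (g.1.1 (.inl ()) (.inr (.inr ()))))
    fun g g' => by
      obtain ⟨u, v, s, rfl⟩ := exists_eq_elem g
      obtain ⟨u', v', s', rfl⟩ := exists_eq_elem g'
      rw [elem_mul]
      exact (hf u v u' v' s s').symm

theorem elem_comm (x y : (Fin m → K) × (Fin m → K)) (s t : K) :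
    elem x.1 x.2 s * elem y.1 y.2 t =
      elem y.1 y.2 t * elem x.1 x.2 s * elem 0 0 (x.1 ⬝ᵥ y.2 - y.1 ⬝ᵥ x.2) := by
  rw [elem_mul, elem_mul, elem_mul, add_zero, add_zero, add_comm x.1, add_comm x.2]
  congr 1
  rw [dotProduct_zero]
  ring

variable (K m) in
/-- The commutation form of the Heisenberg group. -/
def form : LinearMap.BilinForm K ((Fin m → K) × (Fin m → K)) :=
  LinearMap.mk₂ K (fun x y => x.1 ⬝ᵥ y.2 - y.1 ⬝ᵥ x.2)
    (fun x x' y => by simp; ring) (fun c x y => by simp; ring)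
    (fun x y y' => by simp; ring) (fun c x y => by simp; ring)

theorem form_apply (x y : (Fin m → K) × (Fin m → K)) :
    form K m x y = x.1 ⬝ᵥ y.2 - y.1 ⬝ᵥ x.2 := rfl

theorem form_isAlt : (form K m).IsAlt := fun x => sub_self (x.1 ⬝ᵥ x.2)

theorem form_nondegenerate : LinearMap.Nondegenerate (form K m) := by
  have hL : LinearMap.SeparatingLeft (form K m) := fun x h => by
    refine Prod.ext (funext fun i => ?_) (funext fun i => ?_)
    · simpa [form_apply] using h (0, Pi.single i 1)
    · simpa [form_apply] using h (Pi.single i 1, 0)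
  refine ⟨hL, fun y h => hL y fun x => ?_⟩
  rw [← form_isAlt.neg_eq, h, neg_zero]

end Heisenberg

/-! ### Central quotients and commutators -/

section Group

variable {G : Type*} [Group G] (h : commutator G ≤ Subgroup.center G)

theorem CentralQuotient.mk_mul (x y : G) : mk h (x * y) = mk h x + mk h y := rfl

theorem CentralQuotient.mk_surjective : Function.Surjective (mk h) :=
  QuotientGroup.mk_surjective

theorem CentralQuotient.mk_eq_zero {x : G} : mk h x = 0 ↔ x ∈ Subgroup.center G :=
  QuotientGroup.eq_one_iff x

theorem DerivedSubgroup.comm_eq_of_mul_eq {x y z : G} (hz : z ∈ commutator G)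
    (e : x * y = y * x * z) : comm h x y = Additive.ofMul ⟨z, hz⟩ := by
  refine Subtype.ext (?_ : x⁻¹ * y⁻¹ * x * y = z)
  rw [mul_assoc, e]
  group

theorem DerivedSubgroup.mul_eq_mul_comm (x y : G) :
    x * y = y * x * (Additive.toMul (comm h x y)).1 := by
  change x * y = y * x * (x⁻¹ * y⁻¹ * x * y)
  group

theorem Bi_nondegenerate (v : CentralQuotient G h) (hv : ∀ u, (Bi G h).toHom u v = 0) :
    v = 0 := by
  obtain ⟨y, rfl⟩ := CentralQuotient.mk_surjective h v
  rw [CentralQuotient.mk_eq_zero, Subgroup.mem_center_iff]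
  intro x
  have h1 := hv (CentralQuotient.mk h x)
  rw [Bi_mk] at h1
  rw [DerivedSubgroup.mul_eq_mul_comm h x y, h1]
  exact mul_one _

theorem commutator_eq_bot_of_comm (hc : ∀ x y : G, x * y = y * x) : commutator G = ⊥ := by
  rw [eq_bot_iff, commutator_def, Subgroup.commutator_le]
  intro x _ y _
  rw [Subgroup.mem_bot, commutatorElement_eq_one_iff_mul_comm]
  exact hc x y

/-- A surjection of elementary abelian groups splits. -/
theorem AddMonoidHom.exists_section_of_exponent_prime {p : ℕ} (hp : p.Prime) {A U : Type*}
    [AddCommGroup A] [AddCommGroup U] (π : A →+ U) (hA : ∀ a : A, p • a = 0)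
    (hU : ∀ u : U, p • u = 0) (hπ : Function.Surjective π) :
    ∃ σ : U →+ A, ∀ u, π (σ u) = u := by
  have : Fact p.Prime := ⟨hp⟩
  have key : ∀ [Module (ZMod p) A] [Module (ZMod p) U], ∃ σ : U →+ A, ∀ u, π (σ u) = u := by
    intro _ _
    obtain ⟨σ, hσ⟩ := Module.projective_lifting_property
      (AddMonoidHom.toZModLinearMap p π) LinearMap.id hπ
    exact ⟨σ.toAddMonoidHom, fun u => LinearMap.congr_fun hσ u⟩
  exact @key (AddCommGroup.zmodModule hA) (AddCommGroup.zmodModule hU)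

/-- In exponent `p`, a totally isotropic map into the central quotient lifts to the group. -/
theorem CentralQuotient.exists_lift {p : ℕ} (hp : p.Prime) (hexp : ∀ g : G, g ^ p = 1)
    {U : Type*} [AddCommGroup U] (hU : ∀ u : U, p • u = 0) (γ : U →+ CentralQuotient G h)
    (hγ : ∀ u v, (Bi G h).toHom (γ u) (γ v) = 0) :
    ∃ σ : U → G, (∀ u v, σ (u + v) = σ u * σ v) ∧ ∀ u, mk h (σ u) = γ u := by
  -- The fibre product of `U` and `G` over `G/Z(G)`. Isotropy makes it abelian, and it has exponent
  -- dividing `p`, so its projection to `U` splits.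
  let P : Subgroup (Multiplicative U × G) :=
    { carrier := {x | γ x.1.toAdd = mk h x.2}
      mul_mem' := fun {x y} hx hy => by
        change γ (x.1.toAdd + y.1.toAdd) = mk h x.2 + mk h y.2
        rw [map_add, hx, hy]
      one_mem' := map_zero γ
      inv_mem' := fun {x} hx => by
        change γ (-x.1.toAdd) = -mk h x.2
        rw [map_neg, hx] }
  let _ : CommGroup P :=
    { (inferInstance : Group P) with
      mul_comm := by
        rintro ⟨x, hx⟩ ⟨y, hy⟩
        refine Subtype.ext (Prod.ext (mul_comm x.1 y.1) ?_)
        have h1 := hγ x.1.toAdd y.1.toAdd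
        rw [hx, hy, Bi_mk] at h1
        change x.2 * y.2 = y.2 * x.2
        rw [DerivedSubgroup.mul_eq_mul_comm h, h1]
        exact mul_one _ }
  let π : Additive P →+ U := AddMonoidHom.mk' (fun x => x.toMul.1.1.toAdd) fun _ _ => rfl
  have hπ : Function.Surjective π := fun u => by
    obtain ⟨g, hg⟩ := mk_surjective h (γ u)
    exact ⟨Additive.ofMul ⟨(Multiplicative.ofAdd u, g), hg.symm⟩, rfl⟩
  obtain ⟨σ, hσ⟩ := π.exists_section_of_exponent_prime hp
    (fun x => Subtype.ext (Prod.ext (hU _) (hexp _))) hU hπ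
  refine ⟨fun u => (σ u).toMul.1.2, fun u v => ?_, fun u => ?_⟩
  · exact congrArg (fun x : Additive P => x.toMul.1.2) (map_add σ u v)
  · rw [← (σ u).toMul.2]
    exact congrArg γ (hσ u)

end Group

/-! ### Epimorphic images of Heisenberg groups -/

section Main

variable {G : Type*} [Group G] {l : ℕ} {K : Type*} [Field K]

/-- The commutation bimap of a nonabelian quotient of a Heisenberg group, with center equal to the
commutator subgroup, is an additive image of the symplectic form. -/
theorem Heisenberg.exists_coords_of_surjective (hG : commutator G ≠ ⊥)
    (hZ : commutator G = Subgroup.center G) (φ : HeisenbergGroup l K →* G)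
    (hφ : Function.Surjective φ) :
    ∃ (α : (Fin l → K) × (Fin l → K) ≃+ CentralQuotient G hZ.le)
      (ν : K →+ DerivedSubgroup G hZ.le), ν ≠ 0 ∧
      ∀ x y, (Bi G hZ.le).toHom (α x) (α y) = ν (form K l x y) := by
  have hmem : ∀ s : K, φ (elem 0 0 s) ∈ commutator G := by
    intro s
    rcases Nat.eq_zero_or_pos l with rfl | hl
    · refine absurd (commutator_eq_bot_of_comm fun x y => ?_) hG
      obtain ⟨x, rfl⟩ := hφ x
      obtain ⟨y, rfl⟩ := hφ y
      obtain ⟨u, v, s, rfl⟩ := exists_eq_elem x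
      obtain ⟨u', v', s', rfl⟩ := exists_eq_elem y
      rw [← map_mul, ← map_mul, elem_mul, elem_mul, Subsingleton.elim u' u,
        Subsingleton.elim v' v, add_comm s]
    -- For `l > 0` every `elem 0 0 s` is a commutator; for `l = 0` the group `H_0(K)` is abelian and
    -- so is `G`.
    · have h1 := elem_comm ((Pi.single ⟨0, hl⟩ 1, 0) : (Fin l → K) × (Fin l → K))
        (0, Pi.single ⟨0, hl⟩ s) 0 0
      simp only [single_dotProduct, Pi.single_eq_same, one_mul, zero_dotProduct, sub_zero] at h1
      have h2 := congrArg φ h1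
      rw [map_mul, map_mul, map_mul, DerivedSubgroup.mul_eq_mul_comm hZ.le] at h2
      rw [← mul_left_cancel h2]
      exact (Additive.toMul (DerivedSubgroup.comm hZ.le _ _)).2
  let ν : K →+ DerivedSubgroup G hZ.le :=
    AddMonoidHom.mk' (fun s => Additive.ofMul ⟨φ (elem 0 0 s), hmem s⟩) fun s t =>
      Subtype.ext <| by
        change φ (elem 0 0 (s + t)) = φ (elem 0 0 s) * φ (elem 0 0 t)
        rw [← map_mul, elem_mul, add_zero, zero_dotProduct, add_zero]
  have hsplit : ∀ u v s, φ (elem u v s) = φ (elem u v 0) * φ (elem 0 0 s) := fun u v s => by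
    rw [← map_mul, elem_mul, add_zero, add_zero, zero_add, dotProduct_zero, add_zero]
  let α : (Fin l → K) × (Fin l → K) →+ CentralQuotient G hZ.le :=
    AddMonoidHom.mk' (fun x => CentralQuotient.mk hZ.le (φ (elem x.1 x.2 0))) fun x y => by
      rw [← CentralQuotient.mk_mul, ← map_mul, elem_mul, hsplit _ _ (0 + 0 + _),
        CentralQuotient.mk_mul, (CentralQuotient.mk_eq_zero hZ.le).2 (hZ.le (hmem _)), add_zero]
      rfl
  have hb : ∀ x y, (Bi G hZ.le).toHom (α x) (α y) = ν (form K l x y) := fun x y => by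
    refine (Bi_mk G hZ.le _ _).trans (DerivedSubgroup.comm_eq_of_mul_eq hZ.le _ ?_)
    rw [form_apply, ← map_mul, elem_comm, map_mul, map_mul]
  have hne : ν ≠ 0 := by
    intro h0
    refine hG (commutator_eq_bot_of_comm fun x y => ?_)
    obtain ⟨x, rfl⟩ := hφ x
    obtain ⟨y, rfl⟩ := hφ y
    obtain ⟨u, v, s, rfl⟩ := exists_eq_elem x
    obtain ⟨u', v', s', rfl⟩ := exists_eq_elem y
    rw [← map_mul, elem_comm (u, v) (u', v'), map_mul, map_mul]
    have h1 : ν (u ⬝ᵥ v' - u' ⬝ᵥ v) = 0 := by rw [h0, AddMonoidHom.zero_apply]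
    have h2 : φ (elem 0 0 (u ⬝ᵥ v' - u' ⬝ᵥ v)) = 1 := congrArg Subtype.val h1
    rw [h2, mul_one]
  have hinj : Function.Injective α := by
    rw [injective_iff_map_eq_zero]
    intro x hx
    by_contra hx0
    obtain ⟨y, hy⟩ := AltBimap.exists_form_eq_one form_nondegenerate hx0
    -- The values `form x (s • y) = s` exhaust `K`, so `α x = 0` would make `ν` vanish.
    refine hne (AddMonoidHom.ext fun s => ?_)
    have h1 := hb x (s • y)
    rw [hx, map_zero, AddMonoidHom.zero_apply, LinearMap.map_smul, hy, smul_eq_mul, mul_one] at h1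
    exact h1.symm
  have hsurj : Function.Surjective α := by
    intro x
    obtain ⟨g, rfl⟩ := CentralQuotient.mk_surjective hZ.le x
    obtain ⟨g, rfl⟩ := hφ g
    obtain ⟨u, v, s, rfl⟩ := exists_eq_elem g
    refine ⟨(u, v), ?_⟩
    rw [hsplit, CentralQuotient.mk_mul,
      (CentralQuotient.mk_eq_zero hZ.le).2 (hZ.le (hmem _)), add_zero]
    rfl
  exact ⟨AddEquiv.ofBijective α ⟨hinj, hsurj⟩, ν, hne, hb⟩

/-- A group of prime exponent whose commutation bimap is an additive image of the symplectic form
is an epimorphic image of the Heisenberg group. -/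
theorem Heisenberg.exists_surjective_of_coords {p : ℕ} (hp : p.Prime) (hexp : ∀ g : G, g ^ p = 1)
    (hZ : commutator G = Subgroup.center G)
    (α : (Fin l → K) × (Fin l → K) ≃+ CentralQuotient G hZ.le)
    (ν : K →+ DerivedSubgroup G hZ.le)
    (hb : ∀ x y, (Bi G hZ.le).toHom (α x) (α y) = ν (form K l x y)) :
    ∃ φ : HeisenbergGroup l K →* G, Function.Surjective φ := by
  have hV : ∀ x : CentralQuotient G hZ.le, p • x = 0 := fun x => by
    obtain ⟨g, rfl⟩ := CentralQuotient.mk_surjective hZ.le x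
    change CentralQuotient.mk hZ.le (g ^ p) = 0
    rw [hexp]
    rfl
  have hK : ∀ x : (Fin l → K) × (Fin l → K), p • x = 0 := fun x => by
    rw [← α.map_eq_zero_iff, map_nsmul, hV]
  obtain ⟨σ, hσ, hσα⟩ := CentralQuotient.exists_lift hZ.le hp hexp
    (fun u : Fin l → K => congrArg Prod.fst (hK (u, 0)))
    (α.toAddMonoidHom.comp (AddMonoidHom.inl _ _)) fun u v => (hb (u, 0) (v, 0)).trans <| by
      simp [form_apply]
  obtain ⟨ρ, hρ, hρα⟩ := CentralQuotient.exists_lift hZ.le hp hexp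
    (fun u : Fin l → K => congrArg Prod.snd (hK (0, u)))
    (α.toAddMonoidHom.comp (AddMonoidHom.inr _ _)) fun u v => (hb (0, u) (0, v)).trans <| by
      simp [form_apply]
  let z : K → G := fun s => (Additive.toMul (ν s)).1
  have hz : ∀ s t, z (s + t) = z s * z t := fun s t => by
    simp only [z, map_add]
    rfl
  have hzc : ∀ s g, g * z s = z s * g := fun s =>
    Subgroup.mem_center_iff.1 (hZ.le (Additive.toMul (ν s)).2)
  have hcomm : ∀ u v, σ u * ρ v = ρ v * σ u * z (u ⬝ᵥ v) := fun u v => by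
    have h1 := hb (u, 0) (0, v)
    rw [form_apply, zero_dotProduct, sub_zero] at h1
    have h2 : DerivedSubgroup.comm hZ.le (σ u) (ρ v) = ν (u ⬝ᵥ v) := by
      rw [← h1, ← Bi_mk, hσα, hρα]
      rfl
    rw [DerivedSubgroup.mul_eq_mul_comm hZ.le, h2]
  -- The order matters: `elem 0 v 0 * elem u 0 0 = elem u v 0`, while the opposite order adds the
  -- corner entry `u ⬝ᵥ v`.
  let φ : HeisenbergGroup l K →* G := homOfCoords (fun u v s => ρ v * σ u * z s) <| by
    intro u v u' v' s s'
    rw [hσ, hρ, hz, hz]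
    calc ρ v * σ u * z s * (ρ v' * σ u' * z s')
        = ρ v * σ u * (z s * (ρ v' * σ u')) * z s' := by simp only [mul_assoc]
      _ = ρ v * (σ u * ρ v') * σ u' * (z s * z s') := by rw [← hzc]; simp only [mul_assoc]
      _ = ρ v * ρ v' * σ u * (z (u ⬝ᵥ v') * σ u') * (z s * z s') := by
        rw [hcomm]; simp only [mul_assoc]
      _ = ρ v * ρ v' * (σ u * σ u') * (z s * z s' * z (u ⬝ᵥ v')) := by
        rw [← hzc _ (σ u'), hzc (u ⬝ᵥ v') (z s * z s')]; simp only [mul_assoc]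
  have hφ : ∀ u v s, φ (elem u v s) = ρ v * σ u * z s := fun _ _ _ => rfl
  have hz1 : ∀ s, z s ∈ φ.range := fun s => ⟨elem 0 0 s, by
    have h1 : σ 0 = 1 := by simpa using hσ 0 0
    have h2 : ρ 0 = 1 := by simpa using hρ 0 0
    rw [hφ, h1, h2, one_mul, one_mul]⟩
  have hder : commutator G ≤ φ.range := by
    rw [commutator_def, Subgroup.commutator_le]
    intro x _ y _
    -- Inverses reconcile `comm x y = x⁻¹ y⁻¹ x y` with the convention `x y x⁻¹ y⁻¹` behind
    -- `commutator`.
    obtain ⟨a, ha⟩ := α.surjective (CentralQuotient.mk hZ.le x⁻¹)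
    obtain ⟨b, hb'⟩ := α.surjective (CentralQuotient.mk hZ.le y⁻¹)
    have h1 := hb a b
    rw [ha, hb', Bi_mk] at h1
    change x * y * x⁻¹ * y⁻¹ ∈ φ.range
    have h2 : x * y * x⁻¹ * y⁻¹ = z (form K l a b) := by
      simp only [z, ← h1]
      change x * y * x⁻¹ * y⁻¹ = x⁻¹⁻¹ * y⁻¹⁻¹ * x⁻¹ * y⁻¹
      rw [inv_inv, inv_inv]
    rw [h2]
    exact hz1 _
  refine ⟨φ, fun g => ?_⟩
  obtain ⟨⟨u, v⟩, hx⟩ := α.surjective (CentralQuotient.mk hZ.le g)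
  have h1 : CentralQuotient.mk hZ.le (φ (elem u v 0)) = CentralQuotient.mk hZ.le g := by
    rw [← hx, hφ, CentralQuotient.mk_mul, CentralQuotient.mk_mul, hσα, hρα,
      (CentralQuotient.mk_eq_zero hZ.le).2 (hZ.le (Additive.toMul (ν 0)).2), add_zero]
    change α (0, v) + α (u, 0) = α (u, v)
    rw [← map_add, Prod.mk_add_mk, zero_add, add_zero]
  -- The discrepancy is central, hence in `G'`, which the range contains.
  have h2 : (φ (elem u v 0))⁻¹ * g ∈ φ.range := by
    refine hder (hZ.ge ?_)
    rw [← CentralQuotient.mk_eq_zero hZ.le, CentralQuotient.mk_mul, ← h1]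
    exact neg_add_cancel (CentralQuotient.mk hZ.le (φ (elem u v 0)))
  have h3 := mul_mem (⟨_, rfl⟩ : φ (elem u v 0) ∈ φ.range) h2
  rwa [mul_inv_cancel_left] at h3

end Main

theorem mainTheorem4 (p : ℕ) (hp : p.Prime) (hp2 : p ≠ 2)
    (G : Type*) [Group G] [Finite G]
    (hexp : ∀ g : G, g ^ p = 1)
    (hG : ⊥ < commutator G)
    (hZ : commutator G = Subgroup.center G)
    (hlt : Subgroup.center G < ⊤)
    (l : ℕ) (K : Type*) [Field K] [Finite K] :
    (∃ φ : HeisenbergGroup l K →* G, Function.Surjective φ) ↔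
      (IsSimpleModule (Bi G hZ.le).adj (CentralQuotient G hZ.le) ∧
        ∃ (k : Subfield K) (_ : Module k (CentralQuotient G hZ.le))
          (j : LinearMap.BilinForm k (CentralQuotient G hZ.le)) (hj : j.IsAlt),
          LinearMap.Nondegenerate j ∧
          Nonempty ((Bi G hZ.le).adj ≃⋆+* (AltBimap.ofForm j hj).adj) ∧
          Nonempty (k ≃+* Subring.center (Bi G hZ.le).adj) ∧
          Module.finrank k (CentralQuotient G hZ.le) = 2 * l * Module.finrank k K) := by
  have hfin : Finite (CentralQuotient G hZ.le) :=
    Finite.of_surjective _ (CentralQuotient.mk_surjective hZ.le)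
  have hnt : Nontrivial (CentralQuotient G hZ.le) := by
    obtain ⟨g, -, hg⟩ := SetLike.exists_of_lt hlt
    exact ⟨CentralQuotient.mk hZ.le g, 0, fun h0 => hg ((CentralQuotient.mk_eq_zero hZ.le).1 h0)⟩
  constructor
  · rintro ⟨φ, hφ⟩
    obtain ⟨α, ν, hν, hb⟩ := Heisenberg.exists_coords_of_surjective hG.ne' hZ φ hφ
    let _ : Module K (CentralQuotient G hZ.le) := AddEquiv.module K α.symm
    let αL : ((Fin l → K) × (Fin l → K)) ≃ₗ[K] CentralQuotient G hZ.le :=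
      { α with
        map_smul' := fun c x => by
          change α (c • x) = α (c • α.symm (α x))
          rw [α.symm_apply_apply] }
    let J : LinearMap.BilinForm K (CentralQuotient G hZ.le) :=
      (Heisenberg.form K l).comp αL.symm.toLinearMap αL.symm.toLinearMap
    have hJ : J.IsAlt := fun x => Heisenberg.form_isAlt _
    have hJnd : LinearMap.Nondegenerate J := by
      constructor
      · intro x hx
        refine αL.symm.map_eq_zero_iff.1 (Heisenberg.form_nondegenerate.1 _ fun y => ?_)
        simpa [J] using hx (αL y)
      · intro y hy
        refine αL.symm.map_eq_zero_iff.1 (Heisenberg.form_nondegenerate.2 _ fun x => ?_)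
        simpa [J] using hy (αL x)
    have hbJ : ∀ x y, (Bi G hZ.le).toHom x y = ν (J x y) := fun x y => by
      have h1 := hb (α.symm x) (α.symm y)
      rw [α.apply_symm_apply, α.apply_symm_apply] at h1
      exact h1
    obtain ⟨k, j, hj, hjnd, hadj⟩ := AltBimap.exists_subfield_form hJ hJnd hν hbJ
    have e : Nonempty ((Bi G hZ.le).adj ≃⋆+* (AltBimap.ofForm j hj).adj) :=
      ⟨{ RingEquiv.subringCongr hadj with
          map_star' := fun _ => rfl }⟩
    have hdim : Module.finrank K (CentralQuotient G hZ.le) = 2 * l := by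
      rw [← αL.finrank_eq, Module.finrank_prod, Module.finrank_fin_fun, two_mul]
    refine ⟨AltBimap.isSimpleModule_adj_of_le hjnd hadj.ge, k, inferInstance, j, hj, hjnd, e,
      ?_, ?_⟩
    · rw [hadj]
      exact AltBimap.nonempty_equiv_center hjnd
    · rw [← Module.finrank_mul_finrank k K, hdim, mul_comm]
  · rintro ⟨-, k, _, j, hj, hjnd, ⟨ψ⟩, -, hdim⟩
    obtain ⟨θ, τ, hθ⟩ :=
      AltBimap.exists_factorization_of_adj_equiv (Bi_nondegenerate hZ.le) hjnd ψ.symm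
    have hdim' : Module.finrank k ((Fin l → K) × (Fin l → K)) =
        Module.finrank k (CentralQuotient G hZ.le) := by
      rw [hdim, ← Module.finrank_mul_finrank k K, Module.finrank_prod, Module.finrank_fin_fun]
      ring
    -- The standard form, traced down to `k`, is isometric to `j`, so `Bi(G)` becomes `τ ∘ Tr` of
    -- the standard form.
    obtain ⟨β, hβ⟩ := (Heisenberg.form_isAlt.traceDown 1).exists_isometry
      (LinearMap.BilinForm.traceDown_nondegenerate (Heisenberg.form_nondegenerate (K := K) (m := l))
        one_ne_zero) hj hjnd hdim'
    refine Heisenberg.exists_surjective_of_coords hp hexp hZ (β.toAddEquiv.trans θ)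
      (τ.comp (Algebra.trace k K).toAddMonoidHom) fun x y => ?_
    refine (hθ _ _).trans (congrArg τ ((hβ x y).trans ?_))
    rw [LinearMap.BilinForm.traceDown_apply, one_mul]
    rfl
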